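/- Let $n\ge 0$ and $[n]=\{1,\dots,n\}$. A labeled interval order on $[n]$ is a partial order $P$ on $[n]$ for which there are closed real intervals $[l_z,r_z]$, $z\in[n]$, with $x<_P y$ if and only if $r_x<l_y$. For $\pi=a_1\cdots a_n\in\mathcal S_n$ let $D(\pi)=\{i\in[n-1]: a_i>a_{i+1}\}$ be its set of descent positions and $A(\pi)=\{a_i: i\in[n-1],\ a_i<a_{i+1}\}$ its set of ascent bottoms. For $S\subseteq[n-1]$ put $\boldsymbol\alpha_n(S)=\{\pi\in\mathcal S_n: D(\pi)\subseteq S\}$ and $\boldsymbol\lambda_n(S)=\{\tau\in\mathcal S_n: A(\tau)=S\}$. **Theorem.** The labeled interval orders on $[n]$ are in bijection with the disjoint union $$\sum_{S\subseteq[n-1]}\boldsymbol\alpha_n(S)\times\boldsymbol\lambda_n(S),$$ and $(S,\pi,\tau)\mapsto(\pi,\tau)$ is a bijection from this disjoint union onto $$\{(\pi,\tau)\in\mathcal S_n\times\mathcal S_n: D(\pi)\subseteq A(\tau)\}.$$ The bijection can be chosen compatibly with fixed-point matrices, as follows. A ballot is a finite sequence of pairwise disjoint nonempty sets (blocks). A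 ballot matrix on $[n]$ is an upper triangular $m\times m$ matrix of ballots, for some $m$, with no empty row, such that every element of $[n]$ lies in exactly one entry, and all blocks are subsets of $[n]$. It determines the interval order in which $x$, in position $(i,j)$, is smaller than $y$, in position $(i',j')$, if and only if $j<i'$. If every entry has the form $\{a_1\}\cdots\{a_k\}$ with $a_1<\dots<a_k$, an element $x$ in position $(i,j)$ is called a pivot if either row $i$ has at least two elements and $x$ is the smallest of them, or column $i$ is empty, $x$ is the only element on row $i$, and $x$ is smaller than every element of row $i+1$ (which exists). A fixed-point matrix is a ballot matrix whose entries all have this form and which has no pivot. An inversion table is a sequence $b=b_1\cdots b_n$ with $0\le b_i\le n-i$. Every labeled interval order on $[n]$ is determined by exactly one fixed-point matrix. Every fixed-point matrix is $n\times n$ with exactly one element $a_i$ on each row $i$, in column $n-b_i$, for a permutation $\pi=a_1\cdots a_n$ and an inversion table $b=b_1\cdots b_n$. There are a bijection $g$ from inversion tables of length $n$ to $\mathcal S_n$ and a bijection as in the theorem sending the interval order of such a matrix to $(S,\,a_n\cdots a_1,\,g(b))$, where $S=\{b_1,\dots,b_n\}\setminus\{0\}$. -/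

import Mathlib

/-- A labeled interval order on `[n]`: a partial order on the ground set `Fin n` (the element `i`
of `Fin n` plays the role of `i + 1`) that is represented by closed real intervals. -/
def LabeledIntervalOrder (n : ℕ) : Type :=
  {P : PartialOrder (Fin n) //
    ∃ l r : Fin n → ℝ, (∀ z, l z ≤ r z) ∧ ∀ x y, P.lt x y ↔ r x < l y}

/-- The set `D(π) ⊆ [n-1]` of descent positions (counted from 1) of `π = a₁ ⋯ aₙ`,
where `aᵢ` corresponds to `π (i - 1)`. -/
def descentSet {n : ℕ} (π : Equiv.Perm (Fin n)) : Set ℕ :=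
  {k | ∃ i j : Fin n, (j : ℕ) = i + 1 ∧ π j < π i ∧ k = i + 1}

/-- The set `A(π) ⊆ [n-1]` of ascent bottoms (values counted from 1). -/
def ascentBottoms {n : ℕ} (π : Equiv.Perm (Fin n)) : Set ℕ :=
  {k | ∃ i j : Fin n, (j : ℕ) = i + 1 ∧ π i < π j ∧ k = (π i : ℕ) + 1}

/-- Permutations whose descent set is contained in `S`. -/
def alphaSet (n : ℕ) (S : Set ℕ) : Set (Equiv.Perm (Fin n)) :=
  {π | descentSet π ⊆ S}

/-- Permutations whose set of ascent bottoms is exactly `S`. -/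
def lambdaSet (n : ℕ) (S : Set ℕ) : Set (Equiv.Perm (Fin n)) :=
  {τ | ascentBottoms τ = S}

/-- The disjoint union over `S ⊆ [n-1]` of `α_n(S) × λ_n(S)`. -/
abbrev AlphaLambdaSum (n : ℕ) : Type :=
  Σ S : {S : Set ℕ // S ⊆ Set.Icc 1 (n - 1)}, alphaSet n S × lambdaSet n S

/-- The pairs `(π, τ)` with `D(π) ⊆ A(τ)`. -/
abbrev DescentAscentPairs (n : ℕ) : Type :=
  {p : Equiv.Perm (Fin n) × Equiv.Perm (Fin n) // descentSet p.1 ⊆ ascentBottoms p.2}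

/-- The map `(S, π, τ) ↦ (π, τ)`. -/
def forgetSubset (n : ℕ) (t : AlphaLambdaSum n) : DescentAscentPairs n :=
  ⟨(t.2.1.1, t.2.2.1), fun _ hk => t.2.2.2.symm ▸ t.2.1.2 hk⟩

/-- Inversion tables `b₁ ⋯ bₙ` with `0 ≤ bᵢ ≤ n - i` (here `bᵢ` is the value at `i - 1`). -/
def InversionTable (n : ℕ) : Type :=
  {b : Fin n → ℕ // ∀ i : Fin n, b i + (i + 1) ≤ n}

/-- The set of distinct entries of an inversion table. -/
def InversionTable.dent {n : ℕ} (b : InversionTable n) : Set ℕ := Set.range b.1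

/-- Ballot matrices on `[n]`: upper triangular square matrices, without empty rows, whose entries
are ballots (lists of pairwise disjoint nonempty blocks), the underlying sets of the
entries forming a decomposition of the ground set. -/
structure BallotMatrix (n : ℕ) where
  size : ℕ
  entry : Fin size → Fin size → List (Finset (Fin n))
  block_nonempty : ∀ i j, ∀ B ∈ entry i j, B.Nonempty
  block_disjoint : ∀ i j, (entry i j).Pairwise Disjoint
  existsUnique_pos : ∀ x : Fin n, ∃! p : Fin size × Fin size, ∃ B ∈ entry p.1 p.2, x ∈ B
  upper : ∀ i j, j < i → entry i j = []
  row_nonempty : ∀ i, ∃ j, entry i j ≠ []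

namespace BallotMatrix

variable {n : ℕ}

/-- The element `x` belongs to the underlying set of the ballot in position `(i, j)`. -/
def At (A : BallotMatrix n) (i j : Fin A.size) (x : Fin n) : Prop :=
  ∃ B ∈ A.entry i j, x ∈ B

theorem At.le {A : BallotMatrix n} {i j : Fin A.size} {x : Fin n} (h : A.At i j x) : i ≤ j := by
  by_contra hlt
  obtain ⟨B, hB, -⟩ := h
  rw [A.upper i j (not_le.mp hlt)] at hB
  simp at hB

theorem At.unique {A : BallotMatrix n} {i j i' j' : Fin A.size} {x : Fin n}
    (h : A.At i j x) (h' : A.At i' j' x) : i = i' ∧ j = j' := by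
  have := (A.existsUnique_pos x).unique (y₁ := (i, j)) (y₂ := (i', j')) h h'
  exact Prod.mk.inj this

/-- The strict order of the poset of `A`: for `x` in position `(i, j)` and `y` in position
`(i', j')`, `x < y` means `j < i'`. -/
def Below (A : BallotMatrix n) (x y : Fin n) : Prop :=
  ∃ i j i' j', A.At i j x ∧ A.At i' j' y ∧ j < i'

theorem Below.irrefl (A : BallotMatrix n) (x : Fin n) : ¬ A.Below x x := by
  rintro ⟨i, j, i', j', h, h', hlt⟩
  obtain ⟨rfl, rfl⟩ := h.unique h'
  exact absurd h.le (not_le.mpr hlt)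

theorem Below.trans {A : BallotMatrix n} {x y z : Fin n} (h : A.Below x y) (h' : A.Below y z) :
    A.Below x z := by
  obtain ⟨i, j, i', j', hx, hy, hlt⟩ := h
  obtain ⟨k, l, k', l', hy', hz, hlt'⟩ := h'
  obtain ⟨rfl, rfl⟩ := hy.unique hy'
  exact ⟨i, j, k', l', hx, hz, hlt.trans (hy.le.trans_lt hlt')⟩

/-- The poset determined by a ballot matrix. -/
@[reducible]
def poset (A : BallotMatrix n) : PartialOrder (Fin n) where
  le x y := x = y ∨ A.Below x y
  lt x y := A.Below x y
  le_refl x := Or.inl rfl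
  le_trans x y z := by
    rintro (rfl | h) (rfl | h')
    · exact Or.inl rfl
    · exact Or.inr h'
    · exact Or.inr h
    · exact Or.inr (h.trans h')
  lt_iff_le_not_ge x y := by
    constructor
    · intro h
      refine ⟨Or.inr h, ?_⟩
      rintro (rfl | h')
      · exact Below.irrefl A _ h
      · exact Below.irrefl A _ (h.trans h')
    · rintro ⟨rfl | h, h'⟩
      · exact absurd (Or.inl rfl) h'
      · exact h
  le_antisymm x y := by
    rintro (rfl | h) (h' | h')
    · rfl
    · rfl
    · exact h'.symm
    · exact absurd (h.trans h') (Below.irrefl A x)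

/-- The poset determined by a ballot matrix, as a labeled interval order. -/
def toIntervalOrder (A : BallotMatrix n) : LabeledIntervalOrder n :=
  ⟨A.poset, by
    choose p hp _ using A.existsUnique_pos
    refine ⟨fun x => ((p x).1 : ℕ), fun x => ((p x).2 : ℕ), fun z => ?_, fun x y => ?_⟩
    · have h : A.At (p z).1 (p z).2 z := hp z
      exact Nat.cast_le.mpr h.le
    · have hx : A.At (p x).1 (p x).2 x := hp x
      have hy : A.At (p y).1 (p y).2 y := hp y
      constructor
      · rintro ⟨i, j, i', j', h, h', hlt⟩
        obtain ⟨-, rfl⟩ := h.unique hx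
        obtain ⟨rfl, -⟩ := h'.unique hy
        exact Nat.cast_lt.mpr hlt
      · intro hlt
        exact ⟨_, _, _, _, hx, hy, Nat.cast_lt.mp hlt⟩⟩

/-- Every entry is a ballot `{a₁}{a₂}⋯{aₖ}` of singletons with `a₁ < a₂ < ⋯ < aₖ`. -/
def IsSorted (A : BallotMatrix n) : Prop :=
  ∀ i j, ∃ a : List (Fin n), a.Pairwise (· < ·) ∧ A.entry i j = a.map (fun x => {x})

/-- `x`, on row `i` and in column `j`, is a pivot element. -/
def IsPivot (A : BallotMatrix n) (x : Fin n) : Prop :=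
  ∃ i j, A.At i j x ∧
    (((∃ y ≠ x, ∃ k, A.At i k y) ∧ ∀ y k, A.At i k y → x ≤ y) ∨
      ((∀ k, A.entry k i = []) ∧
        (A.entry i j = [{x}] ∧ ∀ k ≠ j, A.entry i k = []) ∧
        ∃ i' : Fin A.size, (i' : ℕ) = i + 1 ∧ ∀ y k, A.At i' k y → x < y))

/-- Fixed-point matrices: the matrices with all entries sorted and without pivot elements. -/
def IsFixedPoint (A : BallotMatrix n) : Prop :=
  A.IsSorted ∧ ∀ x, ¬ A.IsPivot x

/-- `A` is an `n × n` matrix that decomposes into the permutation `π` and the inversion table `b`: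
row `i` contains the element `πᵢ`, located in column `n - bᵢ` (with rows and columns counted
from 1). -/
def DecomposesInto (A : BallotMatrix n) (π : Equiv.Perm (Fin n)) (b : InversionTable n) : Prop :=
  A.size = n ∧ ∀ i : Fin n, ∃ r c : Fin A.size,
    (r : ℕ) = i ∧ (c : ℕ) + 1 + b.1 i = n ∧ A.At r c (π i)

end BallotMatrix

/-! ### Ascent bottoms and insertion of the maximum -/

theorem ascentBottoms_subset {n : ℕ} (π : Equiv.Perm (Fin n)) :
    ascentBottoms π ⊆ Set.Icc 1 (n - 1) := by
  rintro k ⟨i, j, -, hlt, rfl⟩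
  have := (π j).2
  simp only [Set.mem_Icc]
  omega

theorem forgetSubset_bijective (n : ℕ) : Function.Bijective (forgetSubset n) := by
  constructor
  · rintro ⟨⟨S, hS⟩, ⟨π, hπ⟩, ⟨τ, hτ⟩⟩ ⟨⟨S', hS'⟩, ⟨π', hπ'⟩, ⟨τ', hτ'⟩⟩ h
    obtain rfl : ascentBottoms τ = S := hτ
    obtain rfl : ascentBottoms τ' = S' := hτ'
    obtain ⟨e₁, e₂⟩ := Prod.mk.inj (congrArg Subtype.val h)
    obtain rfl : π = π' := e₁
    obtain rfl : τ = τ' := e₂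
    rfl
  · rintro ⟨⟨π, τ⟩, h⟩
    exact ⟨⟨⟨ascentBottoms τ, ascentBottoms_subset τ⟩, ⟨π, h⟩, ⟨τ, rfl⟩⟩, rfl⟩

/-- The permutation of `Fin (n + 1)` obtained from `τ` by inserting the largest value at
position `p`. -/
def insertMaxAt {n : ℕ} (p : Fin (n + 1)) (τ : Equiv.Perm (Fin n)) : Equiv.Perm (Fin (n + 1)) :=
  ((finSuccEquiv' p).trans (Equiv.optionCongr τ)).trans (finSuccEquiv' (Fin.last n)).symm

theorem insertMaxAt_self {n : ℕ} (p : Fin (n + 1)) (τ : Equiv.Perm (Fin n)) :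
    insertMaxAt p τ p = Fin.last n := by
  simp [insertMaxAt]

theorem insertMaxAt_succAbove {n : ℕ} (p : Fin (n + 1)) (τ : Equiv.Perm (Fin n)) (i : Fin n) :
    insertMaxAt p τ (p.succAbove i) = (τ i).castSucc := by
  simp [insertMaxAt]

/-- The position directly after the value `c - 1` of `τ`, or the front position if `c = 0`. -/
def positionAfter {n : ℕ} (τ : Equiv.Perm (Fin n)) (c : Fin (n + 1)) : Fin (n + 1) :=
  Fin.cases 0 (fun u => (τ.symm u).succ) c

theorem positionAfter_injective {n : ℕ} (τ : Equiv.Perm (Fin n)) :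
    Function.Injective (positionAfter τ) := by
  intro c c' h
  induction c using Fin.cases <;> induction c' using Fin.cases <;>
    simp_all [positionAfter, Fin.succ_ne_zero, (Fin.succ_ne_zero _).symm]

theorem insertMaxAt_positionAfter_bijective (n : ℕ) :
    Function.Bijective (fun q : Fin (n + 1) × Equiv.Perm (Fin n) =>
      insertMaxAt (positionAfter q.2 q.1) q.2) := by
  rw [Fintype.bijective_iff_injective_and_card]
  constructor
  · rintro ⟨c, τ⟩ ⟨c', τ'⟩ h
    simp only at h
    have hp : positionAfter τ c = positionAfter τ' c' := by
      apply (insertMaxAt (positionAfter τ' c') τ').injective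
      rw [insertMaxAt_self, ← h, insertMaxAt_self]
    have hτ : τ = τ' := by
      ext i : 1
      apply Fin.castSucc_injective
      rw [← insertMaxAt_succAbove (positionAfter τ c) τ, h, hp, insertMaxAt_succAbove]
    subst hτ
    rw [positionAfter_injective τ hp]
  · simp [Fintype.card_perm, Nat.factorial_succ]

theorem Fin.val_succAbove_eq_ite {n : ℕ} (p : Fin (n + 1)) (i : Fin n) :
    (p.succAbove i : ℕ) = if (i : ℕ) < p then (i : ℕ) else i + 1 := by
  unfold Fin.succAbove
  simp only [Fin.lt_def, Fin.val_castSucc]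
  split_ifs <;> simp

theorem ascentBottoms_insertMaxAt {n : ℕ} (τ : Equiv.Perm (Fin n)) (c : Fin (n + 1)) :
    ascentBottoms (insertMaxAt (positionAfter τ c) τ) = ascentBottoms τ ∪ ({(c : ℕ)} \ {0}) := by
  set p := positionAfter τ c with hp
  ext k
  simp only [Set.mem_union, Set.mem_sdiff, Set.mem_singleton_iff]
  constructor
  · rintro ⟨i, j, hij, hlt, rfl⟩
    have hip : i ≠ p := by
      rintro rfl
      rw [insertMaxAt_self] at hlt
      exact absurd (Fin.le_last _) (not_le.mpr hlt)
    obtain ⟨i', rfl⟩ := Fin.exists_succAbove_eq hip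
    have hi := Fin.val_succAbove_eq_ite p i'
    by_cases hjp : j = p
    · right
      subst hjp
      rw [insertMaxAt_succAbove]
      induction c using Fin.cases with
      | zero => simp [positionAfter] at hp; rw [hp] at hij; simp at hij
      | succ u =>
        have hpu : (p : ℕ) = τ.symm u + 1 := by rw [hp]; simp [positionAfter]
        have hi' : i' = τ.symm u := by
          ext
          split_ifs at hi <;> omega
        subst hi'
        simp
    · left
      obtain ⟨j', rfl⟩ := Fin.exists_succAbove_eq hjp
      have hj := Fin.val_succAbove_eq_ite p j'
      rw [insertMaxAt_succAbove, insertMaxAt_succAbove] at hlt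
      refine ⟨i', j', ?_, hlt, ?_⟩
      · split_ifs at hi hj <;> omega
      · rw [insertMaxAt_succAbove, Fin.val_castSucc]
  · have key : ∀ i' : Fin n, (p : ℕ) = i' + 1 →
        (τ i' : ℕ) + 1 ∈ ascentBottoms (insertMaxAt p τ) := by
      intro i' h
      have hi := Fin.val_succAbove_eq_ite p i'
      rw [if_pos (by omega)] at hi
      refine ⟨p.succAbove i', p, by omega, ?_, ?_⟩
      · rw [insertMaxAt_self, insertMaxAt_succAbove]
        exact Fin.castSucc_lt_last _
      · rw [insertMaxAt_succAbove, Fin.val_castSucc]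
    rintro (⟨i, j, hij, hlt, rfl⟩ | ⟨rfl, hc⟩)
    · by_cases h : (p : ℕ) = i + 1
      · exact key i h
      · refine ⟨p.succAbove i, p.succAbove j, ?_, ?_, ?_⟩
        · rw [Fin.val_succAbove_eq_ite, Fin.val_succAbove_eq_ite]
          split_ifs <;> omega
        · rw [insertMaxAt_succAbove, insertMaxAt_succAbove]
          exact hlt
        · rw [insertMaxAt_succAbove, Fin.val_castSucc]
    · induction c using Fin.cases with
      | zero => simp at hc
      | succ u =>
        have := key (τ.symm u) (by rw [hp]; simp [positionAfter])
        simpa using this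

/-! ### Inversion tables -/

/-- Splitting off the first entry of an inversion table. -/
def InversionTable.consEquiv (n : ℕ) :
    InversionTable (n + 1) ≃ Fin (n + 1) × InversionTable n where
  toFun b := (⟨b.1 0, by have := b.2 0; simp at this; omega⟩,
    ⟨fun i => b.1 i.succ, fun i => by have := b.2 i.succ; simp only [Fin.val_succ] at this ⊢; omega⟩)
  invFun q := ⟨Fin.cases q.1 q.2.1, fun i => by
    induction i using Fin.cases with
    | zero => simp; omega
    | succ i => have := q.2.2 i; simp; omega⟩
  left_inv b := by
    apply Subtype.ext
    funext i
    induction i using Fin.cases <;> rfl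
  right_inv q := rfl

theorem InversionTable.dent_eq_consEquiv {n : ℕ} (b : InversionTable (n + 1)) :
    b.dent = (consEquiv n b).2.dent ∪ {((consEquiv n b).1 : ℕ)} := by
  ext k
  simp only [dent, consEquiv, Set.mem_range, Set.mem_union, Set.mem_singleton_iff,
    Fin.exists_fin_succ, eq_comm (a := k)]
  tauto

theorem exists_equiv_ascentBottoms_eq_dent (n : ℕ) :
    ∃ g : InversionTable n ≃ Equiv.Perm (Fin n), ∀ b, ascentBottoms (g b) = b.dent \ {0} := by
  induction n with
  | zero =>
    refine ⟨⟨fun _ => 1, fun _ => ⟨Fin.elim0, fun i => i.elim0⟩,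
      fun b => Subtype.ext (funext fun i => i.elim0), fun τ => Equiv.ext fun i => i.elim0⟩,
      fun b => ?_⟩
    ext k
    simp [ascentBottoms, InversionTable.dent]
  | succ n ih =>
    obtain ⟨g, hg⟩ := ih
    refine ⟨((InversionTable.consEquiv n).trans ((Equiv.refl _).prodCongr g)).trans
      (Equiv.ofBijective _ (insertMaxAt_positionAfter_bijective n)), fun b => ?_⟩
    rw [b.dent_eq_consEquiv, Set.union_sdiff_distrib, ← hg, ← ascentBottoms_insertMaxAt]
    rfl

/-! ### The matrix of a permutation and an inversion table -/

namespace BallotMatrix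

variable {n : ℕ}

/-- The `n × n` matrix with the single element `π i` on row `i`, in column `n - b i` (counted
from 1). -/
def ofPermTable (π : Equiv.Perm (Fin n)) (b : InversionTable n) : BallotMatrix n where
  size := n
  entry i j := if (j : ℕ) + 1 + b.1 i = n then [{π i}] else []
  block_nonempty i j B hB := by
    split_ifs at hB <;> simp_all
  block_disjoint i j := by
    split_ifs <;> simp
  existsUnique_pos x := by
    have hb := b.2 (π.symm x)
    refine ⟨(π.symm x, ⟨n - 1 - b.1 (π.symm x), by omega⟩), ?_, ?_⟩
    · refine ⟨{x}, ?_, by simp⟩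
      rw [if_pos (by simp only; omega)]
      simp
    · rintro ⟨i, j⟩ ⟨B, hB, hx⟩
      simp only at hB
      split_ifs at hB with h
      · simp only [List.mem_singleton] at hB
        subst hB
        simp only [Finset.mem_singleton] at hx
        subst hx
        simp only [Equiv.symm_apply_apply, Prod.mk.injEq, true_and]
        ext
        simp only
        omega
      · simp at hB
  upper i j h := by
    have hb := b.2 i
    rw [if_neg (by omega)]
  row_nonempty i := by
    have hb := b.2 i
    refine ⟨⟨n - 1 - b.1 i, by omega⟩, ?_⟩
    rw [if_pos (by simp only; omega)]
    simp

theorem ofPermTable_at {π : Equiv.Perm (Fin n)} {b : InversionTable n} {i j : Fin n} {x : Fin n} :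
    (ofPermTable π b).At i j x ↔ (j : ℕ) + 1 + b.1 i = n ∧ x = π i := by
  unfold At
  simp only [ofPermTable]
  split_ifs with h <;> simp [h]

theorem ofPermTable_decomposesInto (π : Equiv.Perm (Fin n)) (b : InversionTable n) :
    (ofPermTable π b).DecomposesInto π b := by
  refine ⟨rfl, fun i => ?_⟩
  have hb := b.2 i
  have h : n - 1 - b.1 i + 1 + b.1 i = n := by omega
  exact ⟨i, (⟨n - 1 - b.1 i, by omega⟩ : Fin n), rfl, h, ofPermTable_at.2 ⟨h, rfl⟩⟩

theorem ofPermTable_below {π : Equiv.Perm (Fin n)} {b : InversionTable n} {i j : Fin n} :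
    (ofPermTable π b).Below (π i) (π j) ↔ n < b.1 i + 1 + j := by
  have hi := b.2 i
  have hj := b.2 j
  constructor
  · rintro ⟨(i₁ : Fin n), (c₁ : Fin n), (i₂ : Fin n), (c₂ : Fin n), h₁, h₂, hlt⟩
    obtain ⟨h₁, e₁⟩ := ofPermTable_at.1 h₁
    obtain ⟨h₂, e₂⟩ := ofPermTable_at.1 h₂
    obtain rfl := π.injective e₁
    obtain rfl := π.injective e₂
    have hlt' : (c₁ : ℕ) < j := hlt
    omega
  · intro h
    refine ⟨i, (⟨n - 1 - b.1 i, by omega⟩ : Fin n), j, (⟨n - 1 - b.1 j, by omega⟩ : Fin n),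
      ofPermTable_at.2 ⟨by simp only; omega, rfl⟩, ofPermTable_at.2 ⟨by simp only; omega, rfl⟩, ?_⟩
    change n - 1 - b.1 i < (j : ℕ)
    omega

/-- Wherever `π` ascends from position `i` to `i + 1`, the column `i` is occupied. -/
def AscentsOccupied (π : Equiv.Perm (Fin n)) (b : InversionTable n) : Prop :=
  ∀ i j : Fin n, (j : ℕ) = i + 1 → π i < π j → ∃ k, b.1 k + (i + 1) = n

theorem ascentsOccupied_iff {π : Equiv.Perm (Fin n)} {b : InversionTable n} :
    AscentsOccupied π b ↔ descentSet (Fin.revPerm.trans π) ⊆ b.dent \ {0} := by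
  constructor
  · rintro h k ⟨i, j, hij, hlt, rfl⟩
    obtain ⟨k, hk⟩ := h j.rev i.rev (by rw [Fin.val_rev, Fin.val_rev]; omega) hlt
    rw [Fin.val_rev] at hk
    exact ⟨⟨k, by omega⟩, by simp⟩
  · intro h i j hij hlt
    obtain ⟨⟨k, hk⟩, -⟩ := @h (j.rev + 1) ⟨j.rev, i.rev,
      by rw [Fin.val_rev, Fin.val_rev]; omega, by simpa using hlt, rfl⟩
    rw [Fin.val_rev] at hk
    exact ⟨k, by omega⟩

theorem ofPermTable_isFixedPoint_iff {π : Equiv.Perm (Fin n)} {b : InversionTable n} :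
    (ofPermTable π b).IsFixedPoint ↔ AscentsOccupied π b := by
  constructor
  · rintro ⟨-, h⟩ i j hij hlt
    by_contra! hk
    have hb := b.2 i
    apply h (π i)
    refine ⟨i, (⟨n - 1 - b.1 i, by omega⟩ : Fin n),
      ofPermTable_at.2 ⟨by simp only; omega, rfl⟩, Or.inr ⟨fun k => ?_, ⟨?_, fun k hkj => ?_⟩,
        j, hij, fun y k hy => ?_⟩⟩
    · exact if_neg (by have := hk k; omega)
    · exact if_pos (by simp only; omega)
    · refine if_neg fun h => hkj ?_
      apply Fin.ext
      simp only
      omega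
    · rw [(ofPermTable_at.1 hy).2]
      exact hlt
  · intro h
    refine ⟨fun i j => ?_, fun x => ?_⟩
    · by_cases hij : (j : ℕ) + 1 + b.1 i = n
      · exact ⟨[π i], by simp, by simp [ofPermTable, hij]⟩
      · exact ⟨[], by simp, by simp [ofPermTable, hij]⟩
    · rintro ⟨(i : Fin n), (j : Fin n), hx, ⟨⟨y, hyx, (k : Fin n), hy⟩, -⟩ |
        ⟨hcol, -, (i' : Fin n), hi', hlt⟩⟩
      · exact hyx ((ofPermTable_at.1 hy).2.trans (ofPermTable_at.1 hx).2.symm)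
      · have hb := b.2 i'
        have hi'' : (i' : ℕ) = i + 1 := hi'
        have hlt' := hlt (π i') (⟨n - 1 - b.1 i', by omega⟩ : Fin n)
          (ofPermTable_at.2 ⟨by simp only; omega, rfl⟩)
        rw [(ofPermTable_at.1 hx).2] at hlt'
        obtain ⟨k, hk⟩ := h i i' hi'' hlt'
        have := hcol k
        have hpos : (ofPermTable π b).entry k i = [{π k}] := if_pos (by omega)
        rw [hpos] at this
        simp at this

theorem exists_at (A : BallotMatrix n) (x : Fin n) : ∃ i j, A.At i j x := by
  obtain ⟨p, hp, -⟩ := A.existsUnique_pos x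
  exact ⟨p.1, p.2, hp⟩

theorem exists_at_row (A : BallotMatrix n) (i : Fin A.size) : ∃ j x, A.At i j x := by
  obtain ⟨j, hj⟩ := A.row_nonempty i
  obtain ⟨B, hB⟩ := List.exists_mem_of_ne_nil _ hj
  obtain ⟨x, hx⟩ := A.block_nonempty i j B hB
  exact ⟨j, x, B, hB, hx⟩

theorem IsFixedPoint.eq_of_at_row {A : BallotMatrix n} (hA : A.IsFixedPoint) {i j j' : Fin A.size}
    {x y : Fin n} (hx : A.At i j x) (hy : A.At i j' y) : x = y := by
  classical
  by_contra hxy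
  let s : Finset (Fin n) := Finset.univ.filter fun z => ∃ k, A.At i k z
  have hs : s.Nonempty := ⟨x, by simpa [s] using ⟨j, hx⟩⟩
  obtain ⟨k, hk⟩ : ∃ k, A.At i k (s.min' hs) := by simpa [s] using s.min'_mem hs
  refine hA.2 (s.min' hs) ⟨i, k, hk, Or.inl ⟨?_, fun z l hz => s.min'_le z ?_⟩⟩
  · by_cases h : x = s.min' hs
    · exact ⟨y, fun h' => hxy (h.trans h'.symm), j', hy⟩
    · exact ⟨x, h, j, hx⟩
  · simpa [s] using ⟨l, hz⟩

theorem IsFixedPoint.exists_eq_ofPermTable {A : BallotMatrix n} (hA : A.IsFixedPoint) :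
    ∃ π b, A = ofPermTable π b := by
  choose row col hat using A.exists_at
  have hrow : Function.Bijective row := by
    constructor
    · intro x y h
      have hx := hat x
      rw [h] at hx
      exact hA.eq_of_at_row hx (hat y)
    · intro i
      obtain ⟨j, x, hx⟩ := A.exists_at_row i
      exact ⟨x, ((hat x).unique hx).1⟩
  have hsize : A.size = n := by simpa using (Fintype.card_of_bijective hrow).symm
  obtain ⟨m, entry, h₁, h₂, h₃, h₄, h₅⟩ := A
  simp only at hsize
  subst hsize
  let π : Equiv.Perm (Fin m) := (Equiv.ofBijective row hrow).symm
  have hπ : ∀ i : Fin m, row (π i) = i := fun i => Equiv.ofBijective_apply_symm_apply row hrow i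
  have hle : ∀ x, (row x : ℕ) ≤ col x := fun x => (hat x).le
  have hlt : ∀ x, (col x : ℕ) < m := fun x => (col x).2
  have hb : ∀ i : Fin m, m - 1 - (col (π i) : ℕ) + (i + 1) ≤ m := fun i => by
    have h := hle (π i)
    rw [hπ] at h
    have := hlt (π i)
    omega
  refine ⟨π, ⟨fun i => m - 1 - col (π i), hb⟩, ?_⟩
  have hent : entry = (ofPermTable π ⟨fun i => m - 1 - col (π i), hb⟩).entry := by
    funext i j
    obtain ⟨a, ha, hent⟩ := hA.1 i j
    have hent : entry i j = a.map (fun x => {x}) := hent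
    have hmem : ∀ x ∈ a, x = π i ∧ j = col (π i) := by
      intro x hx
      have hx' : At ⟨m, entry, h₁, h₂, h₃, h₄, h₅⟩ i j x := by
        refine ⟨{x}, ?_, by simp⟩
        change _ ∈ entry i j
        rw [hent]
        exact List.mem_map_of_mem hx
      have hu := hx'.unique (hat x)
      have : x = π i := hrow.1 (by rw [hπ, hu.1])
      rw [← this]
      exact ⟨rfl, hu.2⟩
    have hcol := hlt (π i)
    simp only [ofPermTable]
    split_ifs with hj
    · have hj' : j = col (π i) := by
        apply Fin.ext
        omega
      have hin : π i ∈ a := by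
        obtain ⟨B, hB, hx⟩ := hat (π i)
        rw [hπ, ← hj'] at hB
        change B ∈ entry i j at hB
        rw [hent] at hB
        obtain ⟨y, hy, rfl⟩ := List.mem_map.1 hB
        rw [Finset.mem_singleton] at hx
        rwa [hx]
      rw [hent]
      have : a = [π i] :=
        List.Perm.eq_singleton <| (List.perm_ext_iff_of_nodup (ha.imp ne_of_lt)
          (List.nodup_singleton _)).2 fun x => by
            rw [List.mem_singleton]
            exact ⟨fun hx => (hmem x hx).1, fun hx => hx ▸ hin⟩
      rw [this]
      rfl
    · rw [hent, List.map_eq_nil_iff, List.eq_nil_iff_forall_not_mem]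
      intro x hx
      apply hj
      rw [(hmem x hx).2]
      omega
  exact (BallotMatrix.mk.injEq ..).mpr ⟨rfl, heq_of_eq hent⟩

end BallotMatrix

/-! ### Sorting the elements of an interval order -/

namespace LabeledIntervalOrder

variable {n : ℕ}

open Classical in
/-- The number of elements below `x`. -/
noncomputable def numBelow (lt : Fin n → Fin n → Prop) (x : Fin n) : ℕ :=
  (Finset.univ.filter fun z => lt z x).card

/-- The key that sorts the elements by the number of elements below, ties being broken by
decreasing label. -/
noncomputable def sortKey (lt : Fin n → Fin n → Prop) (x : Fin n) : ℕ ×ₗ (Fin n)ᵒᵈ :=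
  toLex (numBelow lt x, OrderDual.toDual x)

theorem sortKey_injective (lt : Fin n → Fin n → Prop) : Function.Injective (sortKey lt) := by
  intro x y h
  simpa [sortKey] using congrArg (fun q => (ofLex q).2) h

theorem sortKey_lt_iff {lt : Fin n → Fin n → Prop} {x y : Fin n} :
    sortKey lt x < sortKey lt y ↔
      numBelow lt x < numBelow lt y ∨ numBelow lt x = numBelow lt y ∧ y < x := by
  rw [sortKey, sortKey, Prod.Lex.toLex_lt_toLex]
  rfl

open BallotMatrix

theorem numBelow_lt_of {lt : Fin n → Fin n → Prop} {x y z : Fin n}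
    (h : ∀ w, lt w x → lt w y) (hzx : ¬ lt z x) (hzy : lt z y) :
    numBelow lt x < numBelow lt y := by
  classical
  apply Finset.card_lt_card
  refine ⟨fun w hw => ?_, fun hsub => hzx ?_⟩
  · simpa using h w (by simpa using hw)
  · simpa using hsub (show z ∈ _ by simpa using hzy)

theorem numBelow_mono {lt : Fin n → Fin n → Prop} {x y : Fin n}
    (h : ∀ w, lt w x → lt w y) : numBelow lt x ≤ numBelow lt y := by
  classical
  apply Finset.card_le_card
  intro w hw
  simpa using h w (by simpa using hw)

theorem strictMono_of_lt_next {α : Type*} [Preorder α] {f : Fin n → α}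
    (h : ∀ i j : Fin n, (j : ℕ) = i + 1 → f i < f j) : StrictMono f := by
  cases n with
  | zero => exact fun i => i.elim0
  | succ n => exact Fin.strictMono_iff_lt_succ.2 fun i => h _ _ (by simp)

theorem strictMono_sortKey {π : Equiv.Perm (Fin n)} {b : InversionTable n}
    (h : AscentsOccupied π b) :
    StrictMono (sortKey (ofPermTable π b).Below ∘ π) := by
  apply strictMono_of_lt_next
  intro i j hij
  have hsub : ∀ w, (ofPermTable π b).Below w (π i) → (ofPermTable π b).Below w (π j) := by
    intro w hw
    obtain ⟨k, rfl⟩ := π.surjective w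
    rw [ofPermTable_below] at hw ⊢
    omega
  rw [Function.comp_apply, Function.comp_apply, sortKey_lt_iff]
  by_cases hlt : π i < π j
  · obtain ⟨k, hk⟩ := h i j hij hlt
    left
    apply numBelow_lt_of hsub (z := π k)
    · rw [ofPermTable_below]
      omega
    · rw [ofPermTable_below]
      omega
  · have hne : π j ≠ π i := fun e => by
      have := π.injective e
      subst this
      omega
    rcases (numBelow_mono hsub).lt_or_eq with h' | h'
    · exact Or.inl h'
    · exact Or.inr ⟨h', lt_of_le_of_ne (not_lt.1 hlt) hne⟩

theorem ofPermTable_below_injective {π π' : Equiv.Perm (Fin n)} {b b' : InversionTable n}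
    (h : AscentsOccupied π b) (h' : AscentsOccupied π' b')
    (e : (ofPermTable π b).Below = (ofPermTable π' b').Below) : π = π' ∧ b = b' := by
  have hm := strictMono_sortKey h
  have hm' := strictMono_sortKey h'
  rw [← e] at hm'
  have hπ : π = π' := by
    ext i : 1
    apply sortKey_injective (ofPermTable π b).Below
    refine congrFun ((StrictMono.range_inj hm hm').1 ?_) i
    rw [π.surjective.range_comp, π'.surjective.range_comp]
  subst hπ
  refine ⟨rfl, Subtype.ext (funext fun i => ?_)⟩
  have hi := b.2 i
  have hi' := b'.2 i
  have key : ∀ j : Fin n, n < b.1 i + 1 + j ↔ n < b'.1 i + 1 + j := fun j => by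
    rw [← ofPermTable_below (π := π), ← ofPermTable_below (π := π), e]
  have k₁ := key ⟨n - 1 - b.1 i, by omega⟩
  have k₂ := key ⟨n - 1 - b'.1 i, by omega⟩
  simp only at k₁ k₂
  omega

theorem exists_ofPermTable {lt : Fin n → Fin n → Prop} {l r : Fin n → ℝ} (hlr : ∀ z, l z ≤ r z)
    (hlt : ∀ x y, lt x y ↔ r x < l y) :
    ∃ π b, AscentsOccupied π b ∧ ∀ x y, (ofPermTable π b).Below x y ↔ lt x y := by
  classical
  have hirr : ∀ x, ¬ lt x x := fun x hx => by
    rw [hlt] at hx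
    exact absurd (hlr x) (not_le.2 hx)
  have hnest : ∀ x y z, numBelow lt x ≤ numBelow lt y → lt z x → lt z y := by
    intro x y z hle hzx
    by_contra hzy
    refine absurd hle (not_le.2 (numBelow_lt_of (fun w hw => ?_) hzy hzx))
    rw [hlt] at hw hzx hzy ⊢
    linarith
  let π := Tuple.sort (sortKey lt)
  have hm : StrictMono (sortKey lt ∘ π) :=
    (Tuple.monotone_sort _).strictMono_of_injective ((sortKey_injective _).comp π.injective)
  have hup : ∀ (x : Fin n) {i j : Fin n}, i ≤ j → lt x (π i) → lt x (π j) := by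
    intro x i j hij
    apply hnest
    rcases hij.lt_or_eq with h | rfl
    · rcases sortKey_lt_iff.1 (hm h) with h | h
      · exact h.le
      · exact h.1.le
    · exact le_rfl
  let c : Fin n → ℕ := fun i => (Finset.univ.filter fun j => ¬ lt (π i) (π j)).card
  have hcn : ∀ i, c i ≤ n := fun i => (Finset.card_le_univ _).trans_eq (Fintype.card_fin n)
  have hc : ∀ i j : Fin n, lt (π i) (π j) ↔ c i ≤ j := by
    intro i j
    constructor
    · intro h
      rw [← Fin.card_Iio j]
      apply Finset.card_le_card
      intro k hk
      rw [Finset.mem_Iio]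
      by_contra hjk
      exact (Finset.mem_filter.1 hk).2 (hup _ (not_lt.1 hjk) h)
    · contrapose!
      intro h
      rw [← Nat.succ_le_iff, Nat.succ_eq_add_one, ← Fin.card_Iic j]
      apply Finset.card_le_card
      intro k hk
      exact Finset.mem_filter.2 ⟨Finset.mem_univ _, fun h' => h (hup _ (Finset.mem_Iic.1 hk) h')⟩
  have hci : ∀ i : Fin n, (i : ℕ) + 1 ≤ c i := by
    intro i
    by_contra! h
    exact hirr _ ((hc i i).2 (by omega))
  refine ⟨π, ⟨fun i => n - c i, fun i => ?_⟩, ?_, fun x y => ?_⟩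
  · have := hci i
    have := hcn i
    simp only
    omega
  · intro i j hij hlt'
    have hij' : i < j := by rw [Fin.lt_def]; omega
    have hcard : numBelow lt (π i) < numBelow lt (π j) := by
      rcases sortKey_lt_iff.1 (hm hij') with h | h
      · exact h
      · exact absurd h.2 hlt'.asymm
    obtain ⟨x, hx, hx'⟩ : ∃ x, lt x (π j) ∧ ¬ lt x (π i) := by
      by_contra! h
      exact absurd (numBelow_mono h) (not_le.2 hcard)
    obtain ⟨k, rfl⟩ := π.surjective x
    rw [hc] at hx hx'
    have := hcn k
    exact ⟨k, by simp only; omega⟩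
  · obtain ⟨i, rfl⟩ := π.surjective x
    obtain ⟨j, rfl⟩ := π.surjective y
    refine ofPermTable_below.trans ?_
    rw [hc]
    have := hcn i
    simp only
    omega

theorem ext_lt {P Q : LabeledIntervalOrder n} (h : ∀ x y, P.1.lt x y ↔ Q.1.lt x y) : P = Q :=
  Subtype.ext (PartialOrder.ext_lt h)

/-- The interval orders are parametrized by the pairs `(π, b)` that describe fixed-point
matrices. -/
noncomputable def equivPermTable (n : ℕ) :
    {q : Equiv.Perm (Fin n) × InversionTable n // AscentsOccupied q.1 q.2} ≃
      LabeledIntervalOrder n :=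
  Equiv.ofBijective (fun q => (ofPermTable q.1.1 q.1.2).toIntervalOrder) <| by
    constructor
    · rintro ⟨⟨π, b⟩, h⟩ ⟨⟨π', b'⟩, h'⟩ e
      obtain ⟨rfl, rfl⟩ := ofPermTable_below_injective h h'
        (congrArg (fun P : LabeledIntervalOrder n => P.1.lt) e)
      rfl
    · rintro ⟨P, l, r, hlr, hlt⟩
      obtain ⟨π, b, h, hP⟩ := exists_ofPermTable hlr hlt
      exact ⟨⟨(π, b), h⟩, ext_lt hP⟩

theorem existsUnique_fixedPoint (P : LabeledIntervalOrder n) :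
    ∃! A : BallotMatrix n, A.IsFixedPoint ∧ A.toIntervalOrder = P := by
  obtain ⟨⟨⟨π, b⟩, h⟩, rfl⟩ := (equivPermTable n).surjective P
  refine ⟨ofPermTable π b, ⟨ofPermTable_isFixedPoint_iff.2 h, rfl⟩, ?_⟩
  rintro A ⟨hA, e⟩
  obtain ⟨π', b', rfl⟩ := hA.exists_eq_ofPermTable
  have := (equivPermTable n).injective
    (a₁ := ⟨(π', b'), ofPermTable_isFixedPoint_iff.1 hA⟩) (a₂ := ⟨(π, b), h⟩) e
  simp only [Subtype.mk.injEq, Prod.mk.injEq] at this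
  rw [this.1, this.2]

end LabeledIntervalOrder

open BallotMatrix in
theorem exists_equiv_alphaLambdaSum {n : ℕ} (g : InversionTable n ≃ Equiv.Perm (Fin n))
    (hg : ∀ b, ascentBottoms (g b) = b.dent \ {0}) :
    ∃ E : {q : Equiv.Perm (Fin n) × InversionTable n // AscentsOccupied q.1 q.2} ≃
        AlphaLambdaSum n,
      ∀ q, ((E q).1 : Set ℕ) = q.1.2.dent \ {0} ∧
        ((E q).2.1 : Equiv.Perm (Fin n)) = Fin.revPerm.trans q.1.1 ∧
        ((E q).2.2 : Equiv.Perm (Fin n)) = g q.1.2 := by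
  let E : {q : Equiv.Perm (Fin n) × InversionTable n // AscentsOccupied q.1 q.2} →
      AlphaLambdaSum n := fun q =>
    ⟨⟨q.1.2.dent \ {0}, hg q.1.2 ▸ ascentBottoms_subset _⟩,
      ⟨Fin.revPerm.trans q.1.1, ascentsOccupied_iff.1 q.2⟩, ⟨g q.1.2, hg _⟩⟩
  have hrev : ∀ π : Equiv.Perm (Fin n), Fin.revPerm.trans (Fin.revPerm.trans π) = π := fun π => by
    ext i
    simp
  have hE : Function.Bijective E := by
    constructor
    · rintro ⟨⟨π, b⟩, h⟩ ⟨⟨π', b'⟩, h'⟩ e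
      have e' := congrArg (fun t => (forgetSubset n t).1) e
      obtain ⟨e₁, e₂⟩ := Prod.mk.inj e'
      have e₁ : Fin.revPerm.trans π = Fin.revPerm.trans π' := e₁
      obtain rfl : π = π' := by rw [← hrev π, e₁, hrev]
      obtain rfl : b = b' := g.injective e₂
      rfl
    · rintro ⟨⟨S, hS⟩, ⟨π, hπ⟩, ⟨τ, hτ⟩⟩
      obtain rfl : ascentBottoms τ = S := hτ
      have h : AscentsOccupied (Fin.revPerm.trans π) (g.symm τ) := by
        rw [ascentsOccupied_iff, hrev, ← hg, g.apply_symm_apply]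
        exact hπ
      refine ⟨⟨(_, _), h⟩, (forgetSubset_bijective n).1 (Subtype.ext (Prod.ext ?_ ?_))⟩
      · exact hrev π
      · exact g.apply_symm_apply τ
  exact ⟨Equiv.ofBijective E hE, fun q => ⟨rfl, rfl, rfl⟩⟩

theorem mainTheorem2 (n : ℕ) :
    -- the fixed-point matrices represent each labeled interval order exactly once
    (∀ P : LabeledIntervalOrder n,
      ∃! A : BallotMatrix n, A.IsFixedPoint ∧ A.toIntervalOrder = P) ∧
    -- the bijection, and how it is read off from fixed-point matrices
    (∃ (Φ : LabeledIntervalOrder n ≃ AlphaLambdaSum n)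
        (g : InversionTable n ≃ Equiv.Perm (Fin n)),
      ∀ A : BallotMatrix n, A.IsFixedPoint →
        ∃ (π : Equiv.Perm (Fin n)) (b : InversionTable n),
          A.DecomposesInto π b ∧
          ((Φ A.toIntervalOrder).1 : Set ℕ) = b.dent \ {0} ∧
          ((Φ A.toIntervalOrder).2.1 : Equiv.Perm (Fin n)) = Fin.revPerm.trans π ∧
          ((Φ A.toIntervalOrder).2.2 : Equiv.Perm (Fin n)) = g b) ∧
    -- the second description of the target of the bijection
    Function.Bijective (forgetSubset n) := by
  obtain ⟨g, hg⟩ := exists_equiv_ascentBottoms_eq_dent n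
  obtain ⟨E, hE⟩ := exists_equiv_alphaLambdaSum g hg
  refine ⟨LabeledIntervalOrder.existsUnique_fixedPoint,
    ⟨(LabeledIntervalOrder.equivPermTable n).symm.trans E, g, fun A hA => ?_⟩,
    forgetSubset_bijective n⟩
  obtain ⟨π, b, rfl⟩ := hA.exists_eq_ofPermTable
  have e : (LabeledIntervalOrder.equivPermTable n).symm
      (BallotMatrix.ofPermTable π b).toIntervalOrder =
        ⟨(π, b), BallotMatrix.ofPermTable_isFixedPoint_iff.1 hA⟩ := by
    rw [Equiv.symm_apply_eq]
    rfl
  refine ⟨π, b, BallotMatrix.ofPermTable_decomposesInto π b, ?_⟩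
  rw [Equiv.trans_apply, e]
  exact hE _
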